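/- For a finite graph $H$ with vertex set $V$, $|V|=n$, and a real $k>1$, consider unit vectors $(v_i)_{i\in V}$ in $\mathbb{R}^n$. They form a vector $k$-coloring of $H$ if $\langle v_i,v_j\rangle\le -\frac1{k-1}$ for all edges $\{i,j\}$ of $H$; a strict vector $k$-coloring if $\langle v_i,v_j\rangle=-\frac1{k-1}$ for all edges $\{i,j\}$ of $H$; and a rigid vector $k$-coloring if it is strict and moreover $\langle v_i,v_j\rangle\ge-\frac1{k-1}$ for all non-adjacent $i,j$. For a graph $G$ with complement $\bar G$, let $\vartheta_{1/2}(G)$, $\vartheta(G)$ (the Lovász number) and $\vartheta_2(G)$ be the infimum of all $k>1$ such that $\bar G$ admits a vector, strict vector, and rigid vector $k$-coloring, respectively. Let $G_{n,p}$ be the binomial random graph on $\{1,\dots,n\}$, in which each of the $\binom n2$ possible edges is present independently with probability $p$. **Theorem.** There is a constant $n_0$ (independent of $n$ and $p$) such that the following holds for all $n\ge n_0$ and all $0<p\le 0.99$. Let $m$ be any median of $\vartheta(G_{n,p})$, i.e. $\mathrm{P}(\vartheta(G_{n,p})\le m)\ge\frac12$ and $\mathrm{P}(\vartheta(G_{n,p})\ge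 m)\ge\frac12$. 1. For every real $\xi\ge\max\{10,m^{1/2}\}$, $$\mathrm{P}(\vartheta(G_{n,p})\ge m+\xi)\le 30\exp\left(-\frac{\xi^2}{5m+10\xi}\right).$$ 2. For every real $\xi>10$, $$\mathrm{P}(\vartheta(G_{n,p})\le m-\xi)\le 3\exp\left(-\frac{\xi^2}{10m}\right).$$ The same holds with $\vartheta$ replaced throughout (including in the definition of the median $m$) by $\vartheta_{1/2}$ or by $\vartheta_2$. -/

import Mathlib

open MeasureTheory

namespace SimpleGraph

/-- A vector `k`-coloring of `G` (meant for `k > 1`): one unit vector of `ℝⁿ`, `n` the number of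
vertices, for each vertex, with `⟨v i, v j⟩ ≤ -1/(k-1)` along every edge. -/
def IsVectorColoring {V : Type*} [Fintype V] (G : SimpleGraph V) (k : ℝ)
    (v : V → EuclideanSpace ℝ V) : Prop :=
  (∀ i, ‖v i‖ = 1) ∧ ∀ i j, G.Adj i j → inner ℝ (v i) (v j) ≤ -1 / (k - 1)

/-- A strict vector `k`-coloring: equality `⟨v i, v j⟩ = -1/(k-1)` along every edge. -/
def IsStrictVectorColoring {V : Type*} [Fintype V] (G : SimpleGraph V) (k : ℝ)
    (v : V → EuclideanSpace ℝ V) : Prop :=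
  (∀ i, ‖v i‖ = 1) ∧ ∀ i j, G.Adj i j → inner ℝ (v i) (v j) = -1 / (k - 1)

/-- A rigid vector `k`-coloring: a strict one with, moreover, `⟨v i, v j⟩ ≥ -1/(k-1)` for all
non-adjacent pairs. -/
def IsRigidVectorColoring {V : Type*} [Fintype V] (G : SimpleGraph V) (k : ℝ)
    (v : V → EuclideanSpace ℝ V) : Prop :=
  (∀ i, ‖v i‖ = 1) ∧ (∀ i j, G.Adj i j → inner ℝ (v i) (v j) = -1 / (k - 1)) ∧
    ∀ i j, ¬ G.Adj i j → -1 / (k - 1) ≤ inner ℝ (v i) (v j)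

/-- `ϑ_{1/2}(G)`: the vector chromatic number of the complement of `G`. -/
noncomputable def thetaHalf {V : Type*} [Fintype V] (G : SimpleGraph V) : ℝ :=
  sInf {k : ℝ | 1 < k ∧ ∃ v, Gᶜ.IsVectorColoring k v}

/-- The Lovász number `ϑ(G)`: the strict vector chromatic number of the complement of `G`. -/
noncomputable def lovaszTheta {V : Type*} [Fintype V] (G : SimpleGraph V) : ℝ :=
  sInf {k : ℝ | 1 < k ∧ ∃ v, Gᶜ.IsStrictVectorColoring k v}

/-- `ϑ_2(G)`: the rigid vector chromatic number of the complement of `G`. -/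
noncomputable def thetaTwo {V : Type*} [Fintype V] (G : SimpleGraph V) : ℝ :=
  sInf {k : ℝ | 1 < k ∧ ∃ v, Gᶜ.IsRigidVectorColoring k v}

end SimpleGraph

/-- `m` is a median of the real random variable `X` under `μ`. -/
def IsMedian {Ω : Type*} [MeasurableSpace Ω] (μ : Measure Ω) (X : Ω → ℝ) (m : ℝ) : Prop :=
  1 / 2 ≤ μ.real {ω | X ω ≤ m} ∧ 1 / 2 ≤ μ.real {ω | m ≤ X ω}

/-! All three parameters are values at weight `1` of one kind of semidefinite program, with cone
conditions on the off-diagonal entries. Allowing an arbitrary vertex weight `t`, the cost `K` in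
`Dominates` is subadditive and homogeneous in `t`, and at most `∑ t`. A vertex set where `G` agrees
with a graph of parameter at most `a` costs at most `a` (up to ε), and hence so does a convex
combination `1 - y` of indicators of such sets. Topping this up by diagonal weights to an almost
constant weight gives `(ϑ(G) - a)² ≤ ‖y‖² ϑ(G)` (`sq_coneTheta_sub_le`).

The minimum of `‖y‖²` over such `y` is bounded below by Talagrand's squared convex distance from `G`
to `{ϑ ≤ a}`, when the random graph is a product of independent rows, one per vertex. Talagrand's
inequality then yields `P(ϑ ≤ a) P(ϑ ≥ b) ≤ exp(-(b-a)²/(4b))` (`binomialRandom_real_mul_le`).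
Putting the median at `a` or at `b` makes one factor at least `1/2`, and both tails follow. -/

namespace SimpleGraph

/-! ### The three theta parameters as one cone-constrained program. -/

variable {V : Type*} [Fintype V] (Q P : ConvexCone ℝ ℝ) (G : SimpleGraph V)

/-- The set of all `k > 1` for which `Gᶜ` has a vector `k`-coloring whose excess over `-1/(k-1)` lies
in `Q` along the edges of `Gᶜ` and in `P` along the edges of `G`. -/
def coneColorable : Set ℝ :=
  {k | 1 < k ∧ ∃ v : V → EuclideanSpace ℝ V, (∀ i, ‖v i‖ = 1) ∧
    (∀ i j, Gᶜ.Adj i j → inner ℝ (v i) (v j) + 1 / (k - 1) ∈ Q) ∧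
    ∀ i j, G.Adj i j → inner ℝ (v i) (v j) + 1 / (k - 1) ∈ P}

/-- The common generalization of `thetaHalf`, `lovaszTheta` and `thetaTwo`. -/
noncomputable def coneTheta : ℝ := sInf (coneColorable Q P G)

/-- The cone `{0}` of real numbers. -/
def zeroCone : ConvexCone ℝ ℝ where
  carrier := {0}
  smul_mem' := by simp
  add_mem' := by simp

/-- The cone of nonpositive real numbers. -/
def nonposCone : ConvexCone ℝ ℝ where
  carrier := Set.Iic 0
  smul_mem' := fun _ hc _ hx => Set.mem_Iic.2 (mul_nonpos_of_nonneg_of_nonpos hc.le hx)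
  add_mem' := fun _ hx _ hy => Set.mem_Iic.2 (add_nonpos hx hy)

/-- The cone of nonnegative real numbers. -/
def nonnegCone : ConvexCone ℝ ℝ where
  carrier := Set.Ici 0
  smul_mem' := fun _ hc _ hx => Set.mem_Ici.2 (mul_nonneg hc.le hx)
  add_mem' := fun _ hx _ hy => Set.mem_Ici.2 (add_nonneg hx hy)

lemma mem_zeroCone {x : ℝ} : x ∈ zeroCone ↔ x = 0 := Iff.rfl
lemma mem_nonposCone {x : ℝ} : x ∈ nonposCone ↔ x ≤ 0 := Set.mem_Iic
lemma mem_nonnegCone {x : ℝ} : x ∈ nonnegCone ↔ 0 ≤ x := Set.mem_Ici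

lemma thetaHalf_eq_coneTheta : thetaHalf G = coneTheta nonposCone ⊤ G := by
  unfold thetaHalf coneTheta coneColorable IsVectorColoring
  simp only [mem_nonposCone, neg_div, ← le_neg_iff_add_nonpos_right, ConvexCone.mem_top,
    implies_true, and_true]

lemma lovaszTheta_eq_coneTheta : lovaszTheta G = coneTheta zeroCone ⊤ G := by
  unfold lovaszTheta coneTheta coneColorable IsStrictVectorColoring
  simp only [mem_zeroCone, neg_div, ← eq_neg_iff_add_eq_zero, ConvexCone.mem_top,
    implies_true, and_true]

lemma thetaTwo_eq_coneTheta : thetaTwo G = coneTheta zeroCone nonnegCone G := by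
  unfold thetaTwo coneTheta coneColorable IsRigidVectorColoring
  simp only [mem_zeroCone, mem_nonnegCone, neg_div, ← eq_neg_iff_add_eq_zero,
    neg_le_iff_add_nonneg]
  congr 1
  ext k
  refine and_congr_right fun hk => exists_congr fun v => and_congr_right fun hv =>
    and_congr_right fun _ => ⟨fun h i j hij => h i j (by simp [hij]), fun h i j hij => ?_⟩
  -- A rigid coloring also constrains the diagonal, where `1 ≥ -1/(k-1)` is automatic.
  by_cases e : i = j
  · subst e
    have : 0 < 1 / (k - 1) := by have := sub_pos.2 hk; positivity
    rw [real_inner_self_eq_norm_sq, hv]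
    linarith
  · exact h i j (by by_contra h'; exact hij (by simp [e, h']))

/-! ### Weighted semidefinite program: sublinearity and equivalence with colorings. -/

/-- `G.Dominates Q P K t` says that there is a positive semidefinite matrix `Z` with diagonal at most
`t`, with entries in `P` along edges and in `Q` along non-edges, such that the matrix
`[[K, tᵀ], [t, Z]]` is positive semidefinite. -/
def Dominates (K : ℝ) (t : V → ℝ) : Prop :=
  ∃ Z : V → V → ℝ, (∀ i j, Z i j = Z j i) ∧ (∀ i j, Gᶜ.Adj i j → Z i j ∈ Q) ∧
    (∀ i j, G.Adj i j → Z i j ∈ P) ∧ (∀ i, Z i i ≤ t i) ∧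
    ∀ c : V → ℝ, 0 ≤ ∑ i, ∑ j, c i * c j * Z i j ∧
      (∑ i, t i * c i) ^ 2 ≤ K * ∑ i, ∑ j, c i * c j * Z i j

variable {Q P G} {K K₁ K₂ : ℝ} {t t₁ t₂ : V → ℝ}

/-- Positive semidefinite block matrices add; on the quadratic forms this is the Cauchy–Schwarz
inequality for two summands. -/
lemma Dominates.add (h₁ : G.Dominates Q P K₁ t₁) (h₂ : G.Dominates Q P K₂ t₂)
    (hK₁ : 0 ≤ K₁) (hK₂ : 0 ≤ K₂) : G.Dominates Q P (K₁ + K₂) (t₁ + t₂) := by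
  obtain ⟨Z₁, s₁, q₁, p₁, d₁, f₁⟩ := h₁
  obtain ⟨Z₂, s₂, q₂, p₂, d₂, f₂⟩ := h₂
  refine ⟨Z₁ + Z₂, fun i j => by simp [s₁ i j, s₂ i j],
    fun i j h => Q.add_mem (q₁ i j h) (q₂ i j h), fun i j h => P.add_mem (p₁ i j h) (p₂ i j h),
    fun i => add_le_add (d₁ i) (d₂ i), fun c => ?_⟩
  obtain ⟨n₁, e₁⟩ := f₁ c
  obtain ⟨n₂, e₂⟩ := f₂ c
  simp only [Pi.add_apply, mul_add, add_mul, Finset.sum_add_distrib]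
  refine ⟨add_nonneg n₁ n₂, ?_⟩
  have := Finset.sum_sq_le_sum_mul_sum_of_sq_le_mul (Finset.univ : Finset Bool)
    (r := fun b => bif b then ∑ i, t₁ i * c i else ∑ i, t₂ i * c i)
    (f := fun b => bif b then K₁ else K₂)
    (g := fun b => bif b then ∑ i, ∑ j, c i * c j * Z₁ i j else ∑ i, ∑ j, c i * c j * Z₂ i j)
    (by simp [hK₁, hK₂]) (by simp [n₁, n₂]) (by simp [e₁, e₂])
  simp only [Fintype.univ_bool, Finset.mem_singleton, Bool.true_eq_false, not_false_eq_true,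
    Finset.sum_insert, Finset.sum_singleton, cond_true, cond_false] at this
  linarith

lemma Dominates.smul (h : G.Dominates Q P K t) (hQ : (0 : ℝ) ∈ Q) (hP : (0 : ℝ) ∈ P) {s : ℝ}
    (hs : 0 ≤ s) : G.Dominates Q P (s * K) (s • t) := by
  obtain ⟨Z, sy, q, p, d, f⟩ := h
  have mem (C : ConvexCone ℝ ℝ) (hC : (0 : ℝ) ∈ C) (x : ℝ) (hx : x ∈ C) : s * x ∈ C := by
    obtain rfl | hs := hs.eq_or_lt
    · simpa using hC
    · exact C.smul_mem hs hx
  refine ⟨fun i j => s * Z i j, fun i j => congrArg (s * ·) (sy i j), fun i j h => mem Q hQ _ (q i j h),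
    fun i j h => mem P hP _ (p i j h), fun i => mul_le_mul_of_nonneg_left (d i) hs, fun c => ?_⟩
  have e : ∑ i, ∑ j, c i * c j * (s * Z i j) = s * ∑ i, ∑ j, c i * c j * Z i j := by
    simp only [Finset.mul_sum]
    exact Finset.sum_congr rfl fun i _ => Finset.sum_congr rfl fun j _ => by ring
  have e' : ∑ i, (s • t) i * c i = s * ∑ i, t i * c i := by
    simp only [Finset.mul_sum, Pi.smul_apply, smul_eq_mul, mul_assoc]
  rw [e, e']
  refine ⟨mul_nonneg hs (f c).1, ?_⟩
  have := mul_le_mul_of_nonneg_left (f c).2 (mul_nonneg hs hs)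
  linarith

lemma convex_dominates (hQ : (0 : ℝ) ∈ Q) (hP : (0 : ℝ) ∈ P) (hK : 0 ≤ K) :
    Convex ℝ {t | G.Dominates Q P K t} := by
  intro t₁ h₁ t₂ h₂ a b ha hb hab
  have := (h₁.smul hQ hP ha).add (h₂.smul hQ hP hb) (mul_nonneg ha hK) (mul_nonneg hb hK)
  rwa [← add_mul, hab, one_mul] at this

/-- The diagonal matrix of `t` works, by Cauchy–Schwarz. This prices any correction of a weight by
its total mass. -/
lemma dominates_sum (hQ : (0 : ℝ) ∈ Q) (hP : (0 : ℝ) ∈ P) (ht : ∀ i, 0 ≤ t i) :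
    G.Dominates Q P (∑ i, t i) t := by
  classical
  refine ⟨fun i j => if i = j then t i else 0, fun i j => ?_, fun i j h => ?_, fun i j h => ?_,
    fun i => by simp, fun c => ?_⟩
  · by_cases h : i = j
    · simp [h]
    · simp [h, Ne.symm h]
  · simpa [h.ne] using hQ
  · simpa [h.ne] using hP
  · simp only [mul_ite, mul_zero, Finset.sum_ite_eq, Finset.mem_univ, if_true]
    have n (i : V) : 0 ≤ c i * c i * t i := mul_nonneg (mul_self_nonneg _) (ht i)
    exact ⟨Finset.sum_nonneg fun i _ => n i,
      Finset.sum_sq_le_sum_mul_sum_of_sq_le_mul _ (fun i _ => ht i) (fun i _ => n i)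
        fun i _ => le_of_eq (by ring)⟩

/-- Conjugating `Z` by `diag(1/t)` and multiplying by `τ` preserves the cone conditions, as every
entry is multiplied by a positive number. -/
lemma Dominates.rescale (h : G.Dominates Q P K t) {τ : ℝ} (hτ : 0 < τ) (ht : ∀ i, τ ≤ t i) :
    G.Dominates Q P (K / τ) 1 := by
  obtain ⟨Z, sy, q, p, d, f⟩ := h
  have pos (i : V) : 0 < t i := hτ.trans_le (ht i)
  have pos' (i j : V) : 0 < τ / (t i * t j) := div_pos hτ (mul_pos (pos i) (pos j))
  refine ⟨fun i j => τ / (t i * t j) * Z i j, fun i j => by beta_reduce; rw [sy, mul_comm (t i)],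
    fun i j h => Q.smul_mem (pos' i j) (q i j h), fun i j h => P.smul_mem (pos' i j) (p i j h),
    fun i => ?_, fun c => ?_⟩
  · calc τ / (t i * t i) * Z i i ≤ τ / (t i * t i) * t i :=
          mul_le_mul_of_nonneg_left (d i) (pos' i i).le
      _ = τ / t i := by have := (pos i).ne'; field_simp
      _ ≤ 1 := (div_le_one (pos i)).2 (ht i)
  · have e : ∑ i, ∑ j, c i * c j * (τ / (t i * t j) * Z i j) =
        τ * ∑ i, ∑ j, c i / t i * (c j / t j) * Z i j := by
      simp only [Finset.mul_sum]
      exact Finset.sum_congr rfl fun i _ => Finset.sum_congr rfl fun j _ => by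
        have := (pos i).ne'; have := (pos j).ne'; field_simp
    have e' : ∑ i, (1 : V → ℝ) i * c i = ∑ i, t i * (c i / t i) :=
      Finset.sum_congr rfl fun i _ => by have := (pos i).ne'; simp; field_simp
    obtain ⟨f₁, f₂⟩ := f fun i => c i / t i
    rw [e, e']
    refine ⟨mul_nonneg hτ.le f₁, f₂.trans_eq ?_⟩
    have := hτ.ne'
    field_simp

lemma sum_sum_mul_inner {E : Type*} [NormedAddCommGroup E] [InnerProductSpace ℝ E] (v : V → E)
    (c : V → ℝ) : ∑ i, ∑ j, c i * c j * inner ℝ (v i) (v j) = ‖∑ i, c i • v i‖ ^ 2 := by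
  rw [← real_inner_self_eq_norm_sq, sum_inner]
  simp only [inner_sum, real_inner_smul_left, real_inner_smul_right]
  exact Finset.sum_congr rfl fun i _ => Finset.sum_congr rfl fun j _ => by ring

/-- A coloring for `G'` gives a matrix for every induced subgraph on which `G` and `G'` agree. -/
lemma dominates_of_mem_coneColorable {G' : SimpleGraph V} (hQ : (0 : ℝ) ∈ Q) (hP : (0 : ℝ) ∈ P)
    (hK : K ∈ coneColorable Q P G') (ht : ∀ i, t i = 0 ∨ t i = 1)
    (hG : ∀ i j, t i = 1 → t j = 1 → (G.Adj i j ↔ G'.Adj i j)) : G.Dominates Q P K t := by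
  obtain ⟨hK, v, hv, hq, hp⟩ := hK
  have hK0 : 0 < K := one_pos.trans hK
  have hK1 : 0 < K - 1 := sub_pos.2 hK
  have key (i j : V) : ((K - 1) * inner ℝ (v i) (v j) + 1) / K =
      (K - 1) / K * (inner ℝ (v i) (v j) + 1 / (K - 1)) := by field_simp
  refine ⟨fun i j => t i * t j * (((K - 1) * inner ℝ (v i) (v j) + 1) / K),
    fun i j => by beta_reduce; rw [real_inner_comm, mul_comm (t i)], fun i j h => ?_, fun i j h => ?_,
    fun i => ?_, fun c => ?_⟩
  · obtain hi | hi := ht i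
    · simpa [hi] using hQ
    obtain hj | hj := ht j
    · simpa [hj] using hQ
    beta_reduce
    rw [hi, hj, one_mul, one_mul, key]
    refine Q.smul_mem (by positivity) (hq i j ?_)
    rw [compl_adj, ← hG i j hi hj]
    simpa using h
  · obtain hi | hi := ht i
    · simpa [hi] using hP
    obtain hj | hj := ht j
    · simpa [hj] using hP
    beta_reduce
    rw [hi, hj, one_mul, one_mul, key]
    exact P.smul_mem (by positivity) (hp i j ((hG i j hi hj).1 h))
  · beta_reduce
    rw [real_inner_self_eq_norm_sq, hv]
    obtain hi | hi := ht i
    · simp [hi]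
    · rw [hi]
      apply le_of_eq
      field_simp
      ring
  · have e : ∑ i, ∑ j, c i * c j * (t i * t j * (((K - 1) * inner ℝ (v i) (v j) + 1) / K)) =
        ((K - 1) * ‖∑ i, (t i * c i) • v i‖ ^ 2 + (∑ i, t i * c i) ^ 2) / K := by
      rw [← sum_sum_mul_inner, sq (∑ i, t i * c i), Finset.sum_mul_sum, Finset.mul_sum,
        ← Finset.sum_add_distrib, Finset.sum_div]
      refine Finset.sum_congr rfl fun i _ => ?_
      rw [Finset.mul_sum, ← Finset.sum_add_distrib, Finset.sum_div]
      refine Finset.sum_congr rfl fun j _ => ?_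
      ring
    rw [e]
    refine ⟨by positivity, ?_⟩
    rw [mul_div_cancel₀ _ hK0.ne']
    exact le_add_of_nonneg_left (by positivity)

open scoped MatrixOrder in
lemma exists_inner_eq_of_posSemidef {M : Matrix V V ℝ} (hM : M.PosSemidef) :
    ∃ v : V → EuclideanSpace ℝ V, ∀ i j, inner ℝ (v i) (v j) = M i j := by
  classical
  obtain ⟨B, rfl⟩ := CStarAlgebra.nonneg_iff_eq_star_mul_self.mp hM.nonneg
  refine ⟨fun i => WithLp.toLp 2 fun k => B k i, fun i j => ?_⟩
  simp [PiLp.inner_apply, Matrix.mul_apply, Matrix.star_eq_conjTranspose, mul_comm]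

/-- The Schur complement says that `K Z - J` is positive semidefinite, `J` the all-ones matrix.
Raising its diagonal to `K - 1` keeps it so and leaves the cone conditions alone; dividing by `K -
1` gives the Gram matrix of a coloring. -/
lemma Dominates.mem_coneColorable (h : G.Dominates Q P K 1) (hK : 1 < K) :
    K ∈ coneColorable Q P G := by
  classical
  obtain ⟨Z, sy, q, p, d, f⟩ := h
  have hK0 : 0 < K := one_pos.trans hK
  have hK1 : 0 < K - 1 := sub_pos.2 hK
  let M : Matrix V V ℝ := .of fun i j =>
    (K * Z i j - 1 + if i = j then K * (1 - Z i i) else 0) / (K - 1)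
  have hM : M.PosSemidef := by
    refine .of_dotProduct_mulVec_nonneg ?_ fun c => ?_
    · ext i j
      by_cases h : i = j
      · simp [M, h]
      · simp [M, h, Ne.symm h, sy i j]
    · have e : star c ⬝ᵥ M.mulVec c = (K * (∑ i, ∑ j, c i * c j * Z i j) - (∑ i, c i) ^ 2 +
          ∑ i, c i ^ 2 * (K * (1 - Z i i))) / (K - 1) := by
        rw [sq (∑ i, c i), Finset.sum_mul_sum, Finset.mul_sum, ← Finset.sum_sub_distrib,
          ← Finset.sum_add_distrib, Finset.sum_div]
        simp only [dotProduct, Matrix.mulVec, M, Matrix.of_apply, star_trivial]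
        refine Finset.sum_congr rfl fun i _ => ?_
        have e₁ : c i ^ 2 * (K * (1 - Z i i)) =
            ∑ j, c i * c j * (if i = j then K * (1 - Z i i) else 0) := by simp [sq]
        rw [e₁, Finset.mul_sum, Finset.mul_sum, ← Finset.sum_sub_distrib, ← Finset.sum_add_distrib,
          Finset.sum_div]
        refine Finset.sum_congr rfl fun j _ => ?_
        ring
      rw [e]
      have f₂ := (f c).2
      simp only [Pi.one_apply, one_mul] at f₂
      have : 0 ≤ ∑ i, c i ^ 2 * (K * (1 - Z i i)) := Finset.sum_nonneg fun i _ =>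
        mul_nonneg (sq_nonneg _) (mul_nonneg hK0.le (sub_nonneg.2 (d i)))
      exact div_nonneg (by linarith) hK1.le
  obtain ⟨v, hv⟩ := exists_inner_eq_of_posSemidef hM
  have key {i j : V} (hij : i ≠ j) : inner ℝ (v i) (v j) + 1 / (K - 1) = K / (K - 1) * Z i j := by
    rw [hv]
    simp only [M, Matrix.of_apply, hij, if_false]
    field_simp
    ring
  refine ⟨hK, v, fun i => ?_, fun i j h => ?_, fun i j h => ?_⟩
  · have : ‖v i‖ ^ 2 = 1 := by
      rw [← real_inner_self_eq_norm_sq, hv]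
      simp only [M, Matrix.of_apply, if_true]
      field_simp
      ring
    exact (pow_eq_one_iff_of_nonneg (norm_nonneg _) two_ne_zero).1 this
  · rw [key h.ne]
    exact Q.smul_mem (by positivity) (q i j h)
  · rw [key h.ne]
    exact P.smul_mem (by positivity) (p i j h)

lemma coneColorable_nonempty (hQ : (0 : ℝ) ∈ Q) (hP : (0 : ℝ) ∈ P) :
    (coneColorable Q P G).Nonempty := by
  have h₁ : G.Dominates Q P (∑ _i : V, (2 : ℝ)) fun _ => 2 :=
    dominates_sum hQ hP (by simp)
  -- The slack 4 at zero weight makes the final value `|V| + 2`, exceeding 1 even for empty `V`.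
  have h₂ := h₁.add (t₂ := 0) (K₂ := 4)
    ⟨0, by simp, fun _ _ _ => hQ, fun _ _ _ => hP, by simp, by simp⟩
    (Finset.sum_nonneg (by simp)) (by simp)
  refine ⟨_, (h₂.rescale (τ := 2) (by simp) (by simp)).mem_coneColorable ?_⟩
  have : 0 ≤ ∑ _i : V, (2 : ℝ) := Finset.sum_nonneg (by simp)
  linarith

lemma bddBelow_coneColorable : BddBelow (coneColorable Q P G) := ⟨1, fun _ h => h.1.le⟩

lemma one_le_coneTheta (hQ : (0 : ℝ) ∈ Q) (hP : (0 : ℝ) ∈ P) : 1 ≤ coneTheta Q P G :=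
  le_csInf (coneColorable_nonempty hQ hP) fun _ h => h.1.le

/-! ### Stability under vertex modifications. -/

/-- Stability of `coneTheta` under the convex hull of vertex modifications. -/
theorem sq_coneTheta_sub_le (hQ : (0 : ℝ) ∈ Q) (hP : (0 : ℝ) ∈ P) {a : ℝ} {D : Set (V → ℝ)}
    (hD : ∀ d ∈ D, (∀ i, d i = 0 ∨ d i = 1) ∧ ∃ G' : SimpleGraph V, coneTheta Q P G' ≤ a ∧
      ∀ i j, d i = 0 → d j = 0 → (G.Adj i j ↔ G'.Adj i j))
    {y : V → ℝ} (hy : y ∈ convexHull ℝ D) (ha : a ≤ coneTheta Q P G) :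
    (coneTheta Q P G - a) ^ 2 ≤ (∑ i, y i ^ 2) * coneTheta Q P G := by
  have hT1 : 1 ≤ coneTheta Q P G := one_le_coneTheta hQ hP
  have ha1 : 1 ≤ a := by
    obtain ⟨d, hd⟩ := convexHull_nonempty_iff.1 ⟨y, hy⟩
    obtain ⟨-, G', h, -⟩ := hD d hd
    exact (one_le_coneTheta hQ hP).trans h
  set T := coneTheta Q P G with hT
  obtain rfl | ha := ha.eq_or_lt
  · simpa using mul_nonneg (Finset.sum_nonneg fun i _ => sq_nonneg (y i)) (zero_le_one.trans hT1)
  have hT0 : 0 < T := by linarith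
  -- Chosen so that the loss `T * c` below is exactly half of `T - a`.
  set c := (T - a) / (2 * T) with hc
  have hc0 : 0 < c := div_pos (by linarith) (by linarith)
  have hc1 : 0 < 1 - c := by
    have : c < 1 := (div_lt_one (by linarith)).2 (by linarith)
    linarith
  -- By convexity it suffices to treat `1 - d`, the indicator of a set where `G` and some `G'`
  -- agree. The inequality is strict because the infimum for `G'` is not known to be attained.
  have hyD (K : ℝ) (hK : a < K) : G.Dominates Q P K (1 - y) := by
    have cv : Convex ℝ {y : V → ℝ | G.Dominates Q P K (1 - y)} := by
      intro y₁ h₁ y₂ h₂ s r hs hr hsr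
      have := convex_dominates hQ hP (by linarith : 0 ≤ K) h₁ h₂ hs hr hsr
      have e : s • (1 - y₁) + r • (1 - y₂) = 1 - (s • y₁ + r • y₂) := by
        rw [smul_sub, smul_sub, sub_add_sub_comm, ← add_smul, hsr, one_smul]
      rwa [e] at this
    refine convexHull_min (fun d hd => ?_) cv hy
    obtain ⟨h01, G', hG', hadj⟩ := hD d hd
    obtain ⟨k, hk, hkK⟩ := exists_lt_of_csInf_lt (coneColorable_nonempty hQ hP) (hG'.trans_lt hK)
    obtain ⟨Z, sy, q, p, dg, f⟩ := dominates_of_mem_coneColorable (G := G) (t := 1 - d) hQ hP hk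
      (fun i => (h01 i).symm.imp (by simp +contextual) (by simp +contextual))
      (fun i j hi hj => hadj i j (by simpa using hi) (by simpa using hj))
    exact ⟨Z, sy, q, p, dg, fun c => ⟨(f c).1,
      (f c).2.trans (mul_le_mul_of_nonneg_right hkK.le (f c).1)⟩⟩
  -- The least correction lifting `1 - y` to `1 - c` everywhere; its mass is controlled by `y - c ≤
  -- y² / (4c)`.
  let ν : V → ℝ := fun i => max (y i - c) 0
  have hν (i : V) : 0 ≤ ν i := le_max_right _ _
  have hν0 : 0 ≤ ∑ i, ν i := Finset.sum_nonneg fun i _ => hν i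
  have hνs : ∑ i, ν i ≤ (∑ i, y i ^ 2) / (4 * c) := by
    rw [Finset.sum_div]
    refine Finset.sum_le_sum fun i _ => max_le ?_ (by positivity)
    rw [le_div_iff₀ (by positivity)]
    nlinarith [sq_nonneg (y i - 2 * c)]
  have main : T * (1 - c) ≤ a + ∑ i, ν i := by
    refine le_of_forall_pos_le_add fun ε hε => ?_
    have h := ((hyD (a + ε) (by linarith)).add (dominates_sum hQ hP hν) (by linarith) hν0).rescale
      hc1 (fun i => by
        have : y i - c ≤ ν i := le_max_left _ _
        simp only [Pi.add_apply, Pi.sub_apply, Pi.one_apply]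
        linarith)
    have := csInf_le bddBelow_coneColorable
      (h.mem_coneColorable ((one_lt_div hc1).2 (by linarith)))
    have := (le_div_iff₀ hc1).1 this
    change T * (1 - c) ≤ _ at this
    linarith
  have e₁ : T * (1 - c) = T - (T - a) / 2 := by rw [hc]; field_simp
  have e₂ : (∑ i, y i ^ 2) / (4 * c) = (∑ i, y i ^ 2) * T / (2 * (T - a)) := by
    have : T - a ≠ 0 := by linarith
    rw [hc]; field_simp; ring
  rw [e₂] at hνs
  have := hνs.trans' (by linarith : (T - a) / 2 ≤ _)
  rw [le_div_iff₀ (by linarith)] at this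
  linarith

end SimpleGraph

/-! ### Talagrand's convex distance inequality on finite product spaces. -/

section Talagrand

variable {α : Type*} {n : ℕ}

/-- The product of the point masses `w i (x i)`. -/
def prodWeight (w : Fin n → α → ℝ) (x : Fin n → α) : ℝ := ∏ i, w i (x i)

/-- The mass of a finite set under the product of the weights `w i`. -/
def prodMass (w : Fin n → α → ℝ) (A : Finset (Fin n → α)) : ℝ := ∑ x ∈ A, prodWeight w x

lemma prodWeight_nonneg {w : Fin n → α → ℝ} (hw : ∀ i a, 0 ≤ w i a) (x : Fin n → α) :
    0 ≤ prodWeight w x := Finset.prod_nonneg fun _ _ => hw _ _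

lemma prodMass_nonneg {w : Fin n → α → ℝ} (hw : ∀ i a, 0 ≤ w i a) (A : Finset (Fin n → α)) :
    0 ≤ prodMass w A := Finset.sum_nonneg fun _ _ => prodWeight_nonneg hw _

lemma prodWeight_cons (w : Fin (n + 1) → α → ℝ) (a : α) (x : Fin n → α) :
    prodWeight w (Fin.cons a x) = w 0 a * prodWeight (fun i => w i.succ) x := by
  simp [prodWeight, Fin.prod_univ_succ]

/-- The indicator vector of the coordinates in which `z` differs from `x`. -/
def diffVec [DecidableEq α] (x z : Fin n → α) : Fin n → ℝ := fun i => if z i = x i then 0 else 1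

lemma diffVec_cons [DecidableEq α] (a b : α) (x z : Fin n → α) :
    diffVec (Fin.cons a x : Fin (n + 1) → α) (Fin.cons b z) =
      Fin.cons (if b = a then 0 else 1) (diffVec x z) := by
  ext i
  refine Fin.cases ?_ (fun i => ?_) i <;> simp [diffVec]

lemma sum_fin_succ_pi [Fintype α] (f : (Fin (n + 1) → α) → ℝ) :
    ∑ x, f x = ∑ a, ∑ x : Fin n → α, f (Fin.cons a x) := by
  rw [← Fintype.sum_prod_type', ← (Fin.consEquiv fun _ => α).sum_comp]
  rfl

variable [Fintype α] [DecidableEq α]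

lemma prodMass_succ (w : Fin (n + 1) → α → ℝ) (A : Finset (Fin (n + 1) → α)) :
    prodMass w A = ∑ a, w 0 a *
      prodMass (fun i => w i.succ)
        (Finset.univ.filter fun x => (Fin.cons a x : Fin (n + 1) → α) ∈ A) := by
  simp only [prodMass, Finset.sum_filter, Finset.mul_sum, mul_ite, mul_zero, ← prodWeight_cons]
  rw [← sum_fin_succ_pi fun x => if x ∈ A then prodWeight w x else 0]
  simp

lemma smul_cons_add_smul_cons (s r t t' : ℝ) (y y' : Fin n → ℝ) :
    s • (Fin.cons t y : Fin (n + 1) → ℝ) + r • (Fin.cons t' y' : Fin (n + 1) → ℝ) =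
      Fin.cons (s * t + r * t') (s • y + r • y') := by
  ext i
  refine Fin.cases ?_ (fun i => ?_) i <;> simp

/-- The `y` with an admissible first coordinate form a convex set, so liftability passes from `D` to
its hull. -/
lemma exists_cons_mem_of_mem_convexHull {C : Set (Fin (n + 1) → ℝ)} (hC : Convex ℝ C)
    {D : Set (Fin n → ℝ)} {τ : ℝ}
    (h : ∀ d ∈ D, ∃ t, 0 ≤ t ∧ t ≤ τ ∧ (Fin.cons t d : Fin (n + 1) → ℝ) ∈ C)
    {y : Fin n → ℝ} (hy : y ∈ convexHull ℝ D) :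
    ∃ t, 0 ≤ t ∧ t ≤ τ ∧ (Fin.cons t y : Fin (n + 1) → ℝ) ∈ C := by
  refine convexHull_min (t := {y | ∃ t, 0 ≤ t ∧ t ≤ τ ∧ (Fin.cons t y : Fin (n + 1) → ℝ) ∈ C})
    h ?_ hy
  rintro y₁ ⟨t₁, h₁, l₁, m₁⟩ y₂ ⟨t₂, h₂, l₂, m₂⟩ s r hs hr hsr
  refine ⟨s * t₁ + r * t₂, by positivity, ?_, ?_⟩
  · calc s * t₁ + r * t₂ ≤ s * τ + r * τ := by gcongr
      _ = τ := by rw [← add_mul, hsr, one_mul]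
  · rw [← smul_cons_add_smul_cons]
    exact hC m₁ m₂ hs hr hsr

/-- Both sides expand as `1 + L - L²/2` to second order, and the `-L³` coming from `(L - L²)²/2`
absorbs the higher terms on the left. -/
lemma exp_sub_sq_le {L : ℝ} (h0 : 0 ≤ L) (h1 : L ≤ 1 / 2) :
    Real.exp (L - L ^ 2) ≤ 2 - Real.exp (-L) := by
  have hu : 0 ≤ L - L ^ 2 := by nlinarith
  have h₁ := Real.exp_bound' hu (by nlinarith) (n := 3) (by norm_num)
  simp only [Finset.sum_range_succ, Finset.sum_range_zero, Nat.factorial] at h₁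
  norm_num at h₁
  have h₂ : Real.exp (-L) ≤ 1 - L + L ^ 2 / 2 := by
    have h := Real.quadratic_le_exp_of_nonneg h0
    have hp : 0 ≤ 1 - L + L ^ 2 / 2 := by nlinarith
    have := mul_le_mul_of_nonneg_right (mul_le_mul_of_nonneg_right h hp) (Real.exp_pos (-L)).le
    have e : Real.exp L * Real.exp (-L) = 1 := by rw [← Real.exp_add]; simp
    have hE := Real.exp_pos (-L)
    nlinarith [mul_nonneg (pow_nonneg h0 4) hE.le]
  have h₃ : (L - L ^ 2) ^ 3 ≤ L ^ 3 := pow_le_pow_left₀ hu (by nlinarith) 3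
  have h₄ : 0 ≤ L ^ 3 := by positivity
  have h₅ : L ^ 4 ≤ L ^ 3 * (1 / 2) := by
    rw [pow_succ]; gcongr
  nlinarith

/-- The optimization in Talagrand's induction, with `exp (-L)` the ratio of the masses of a slice
and of the projection. The exponent is minimized at `s = 1 - 2L`, with value `L - L²`, or at `s = 0`
once `L ≥ 1/2`. -/
lemma exists_exp_le_two_sub_exp {L : ℝ} (h0 : 0 ≤ L) :
    ∃ s, 0 ≤ s ∧ s ≤ 1 ∧ Real.exp ((1 - s) ^ 2 / 4 + s * L) ≤ 2 - Real.exp (-L) := by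
  obtain h | h := le_total L (1 / 2)
  · refine ⟨1 - 2 * L, by linarith, by linarith, ?_⟩
    convert exp_sub_sq_le h0 h using 2
    ring
  · refine ⟨0, le_rfl, zero_le_one, ?_⟩
    have h₁ := exp_sub_sq_le (L := 1 / 2) (by norm_num) le_rfl
    have h₂ : Real.exp (-L) ≤ Real.exp (-(1 / 2)) := Real.exp_le_exp.2 (by linarith)
    norm_num at h₁ ⊢
    linarith

/-- Hölder's inequality in exponential form. -/
lemma sum_mul_exp_le_exp {ι : Type*} [Fintype ι] {W u v : ι → ℝ} (hW : ∀ i, 0 ≤ W i) {p q s : ℝ}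
    (hs : 0 ≤ s) (hs1 : s ≤ 1) (hu : ∑ i, W i * Real.exp (u i) ≤ Real.exp p)
    (hv : ∑ i, W i * Real.exp (v i) ≤ Real.exp q) :
    ∑ i, W i * Real.exp (s * u i + (1 - s) * v i) ≤ Real.exp (s * p + (1 - s) * q) := by
  have h (i : ι) : W i * Real.exp (s * u i + (1 - s) * v i) ≤ Real.exp (s * p + (1 - s) * q) *
      (s * Real.exp (-p) * (W i * Real.exp (u i)) +
        (1 - s) * Real.exp (-q) * (W i * Real.exp (v i))) := by
    -- Normalizing by `exp (-p)` and `exp (-q)` makes both sums at most 1, so weighted AM–GM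
    -- suffices termwise.
    have c := convexOn_exp.2 (Set.mem_univ (-p + u i)) (Set.mem_univ (-q + v i)) hs
      (sub_nonneg.2 hs1) (by ring)
    simp only [smul_eq_mul] at c
    have e : s * u i + (1 - s) * v i =
        (s * p + (1 - s) * q) + (s * (-p + u i) + (1 - s) * (-q + v i)) := by ring
    rw [e, Real.exp_add]
    rw [Real.exp_add (-p), Real.exp_add (-q)] at c
    have := mul_le_mul_of_nonneg_left c
      (mul_nonneg (hW i) (Real.exp_pos (s * p + (1 - s) * q)).le)
    linarith
  refine (Finset.sum_le_sum fun i _ => h i).trans ?_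
  rw [← Finset.mul_sum, Finset.sum_add_distrib, ← Finset.mul_sum, ← Finset.mul_sum]
  have hp : s * Real.exp (-p) * ∑ i, W i * Real.exp (u i) ≤ s := by
    refine (mul_le_mul_of_nonneg_left hu (by positivity)).trans_eq ?_
    rw [mul_assoc, ← Real.exp_add]; simp
  have hq : (1 - s) * Real.exp (-q) * ∑ i, W i * Real.exp (v i) ≤ 1 - s := by
    have : 0 ≤ 1 - s := sub_nonneg.2 hs1
    refine (mul_le_mul_of_nonneg_left hv (by positivity)).trans_eq ?_
    rw [mul_assoc, ← Real.exp_add]; simp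
  exact mul_le_of_le_one_right (Real.exp_pos _).le (by linarith)

/-- **Talagrand's convex distance inequality** for a product of finite probability spaces. -/
theorem talagrand_convex_distance (w : Fin n → α → ℝ) (hw : ∀ i a, 0 ≤ w i a)
    (hw1 : ∀ i, ∑ a, w i a = 1) (A : Finset (Fin n → α)) (hA : 0 < prodMass w A) :
    ∃ y : (Fin n → α) → Fin n → ℝ, (∀ x, y x ∈ convexHull ℝ (diffVec x '' A)) ∧
      ∑ x, prodWeight w x * Real.exp ((∑ i, y x i ^ 2) / 4) ≤ 1 / prodMass w A := by
  induction n with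
  | zero =>
    have hne : A.Nonempty := by
      by_contra h
      simp [Finset.not_nonempty_iff_eq_empty.1 h, prodMass] at hA
    obtain ⟨z, hz⟩ := hne
    have hA : A = Finset.univ := Finset.eq_univ_of_forall fun x => Subsingleton.elim z x ▸ hz
    refine ⟨0, fun x => subset_convexHull _ _ ⟨z, hz, Subsingleton.elim _ _⟩, ?_⟩
    simp [hA, prodMass, prodWeight]
  | succ n ih =>
    set w' : Fin n → α → ℝ := fun i => w i.succ with hw'
    let S : α → Finset (Fin n → α) := fun a =>
      Finset.univ.filter fun x => (Fin.cons a x : Fin (n + 1) → α) ∈ A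
    -- A hull point for `Fin.cons a x` comes either from the slice `S a`, with first coordinate 0,
    -- or from the projection `B`, with first coordinate at most 1. The induction mixes the two.
    let B : Finset (Fin n → α) := A.image Fin.tail
    have hS (a : α) : S a ⊆ B := fun x hx => Finset.mem_image.2
      ⟨Fin.cons a x, by simpa [S] using hx, Fin.tail_cons _ _⟩
    have hSB (a : α) : prodMass w' (S a) ≤ prodMass w' B :=
      Finset.sum_le_sum_of_subset_of_nonneg (hS a) fun _ _ _ =>
        prodWeight_nonneg (fun i b => hw _ b) _
    have hsum : prodMass w A = ∑ a, w 0 a * prodMass w' (S a) := prodMass_succ w A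
    have hAB : prodMass w A ≤ prodMass w' B := by
      rw [hsum]
      calc _ ≤ ∑ a, w 0 a * prodMass w' B :=
            Finset.sum_le_sum fun a _ => mul_le_mul_of_nonneg_left (hSB a) (hw 0 a)
        _ = _ := by rw [← Finset.sum_mul, hw1, one_mul]
    have hB : 0 < prodMass w' B := hA.trans_le hAB
    set b := prodMass w' B with hb
    obtain ⟨yB, hyB, hEB⟩ := ih w' (fun i => hw _) (fun i => hw1 _) B hB
    have hullB (a : α) (x : Fin n → α) : ∃ t : ℝ, 0 ≤ t ∧ t ≤ 1 ∧
        (Fin.cons t (yB x) : Fin (n + 1) → ℝ) ∈ convexHull ℝ (diffVec (Fin.cons a x) '' A) := by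
      refine exists_cons_mem_of_mem_convexHull (convex_convexHull ℝ _) ?_ (hyB x)
      rintro _ ⟨z, hz, rfl⟩
      obtain ⟨z, hzA, rfl⟩ := Finset.mem_image.1 hz
      refine ⟨if z 0 = a then 0 else 1, by split_ifs <;> simp, by split_ifs <;> simp,
        subset_convexHull _ _ ⟨z, hzA, ?_⟩⟩
      rw [← diffVec_cons, Fin.cons_self_tail]
    choose t ht0 ht1 htB using hullB
    have fiber (a : α) : ∃ y : (Fin n → α) → Fin (n + 1) → ℝ,
        (∀ x, y x ∈ convexHull ℝ (diffVec (Fin.cons a x) '' A)) ∧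
        ∑ x, prodWeight w' x * Real.exp ((∑ i, y x i ^ 2) / 4) ≤
          1 / b * (2 - prodMass w' (S a) / b) := by
      have hW (x : Fin n → α) : 0 ≤ prodWeight w' x := prodWeight_nonneg (fun i c => hw _ c) x
      -- A slice of mass zero is not covered by the induction hypothesis; there the projection alone
      -- suffices, since `exp (1/4) ≤ 2`.
      obtain h0 | h0 := (prodMass_nonneg (fun i c => hw _ c) (S a) : 0 ≤ prodMass w' (S a)).eq_or_lt
      · refine ⟨fun x => Fin.cons (t a x) (yB x), fun x => htB a x, ?_⟩
        rw [← h0, zero_div, sub_zero]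
        have e4 : Real.exp (1 / 4) ≤ 2 := by
          have h₁ := exp_sub_sq_le (L := 1 / 2) (by norm_num) le_rfl
          have h₂ := Real.exp_pos (-(1 / 2))
          norm_num at h₁ h₂ ⊢
          linarith
        calc _ ≤ ∑ x, Real.exp (1 / 4) * (prodWeight w' x * Real.exp ((∑ i, yB x i ^ 2) / 4)) := by
              refine Finset.sum_le_sum fun x _ => ?_
              rw [mul_left_comm, ← Real.exp_add]
              refine mul_le_mul_of_nonneg_left (Real.exp_le_exp.2 ?_) (hW x)
              simp only [Fin.sum_univ_succ, Fin.cons_zero, Fin.cons_succ]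
              have : t a x ^ 2 ≤ 1 := pow_le_one₀ (ht0 a x) (ht1 a x)
              linarith
          _ ≤ 2 * (1 / b) := by
              rw [← Finset.mul_sum]
              exact mul_le_mul e4 hEB (Finset.sum_nonneg fun x _ => mul_nonneg (hW x)
                (Real.exp_pos _).le) zero_le_two
          _ = _ := mul_comm _ _
      · obtain ⟨yS, hyS, hES⟩ := ih w' (fun i => hw _) (fun i => hw1 _) (S a) h0
        have hullS (x : Fin n → α) :
            (Fin.cons 0 (yS x) : Fin (n + 1) → ℝ) ∈ convexHull ℝ (diffVec (Fin.cons a x) '' A) := by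
          obtain ⟨t, h, h', ht⟩ := exists_cons_mem_of_mem_convexHull (τ := 0)
            (convex_convexHull ℝ (diffVec (Fin.cons a x) '' (A : Set (Fin (n + 1) → α)))) (by
              rintro _ ⟨z, hz, rfl⟩
              refine ⟨0, le_rfl, le_rfl, subset_convexHull _ _ ⟨Fin.cons a z, ?_, ?_⟩⟩
              · simpa [S] using hz
              · simp [diffVec_cons]) (hyS x)
          rwa [le_antisymm h' h] at ht
        set m := prodMass w' (S a) with hm
        have hp : Real.exp (-Real.log m) = 1 / m := by rw [Real.exp_neg, Real.exp_log h0, one_div]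
        have hq : Real.exp (-Real.log b) = 1 / b := by rw [Real.exp_neg, Real.exp_log hB, one_div]
        -- The mixing weight `s` of the slice, for `L = log (b / m)`.
        obtain ⟨s, hs0, hs1, hs⟩ := exists_exp_le_two_sub_exp
          (sub_nonneg.2 (Real.log_le_log h0 (hSB a)))
        have hr : Real.exp (-(Real.log b - Real.log m)) = m / b := by
          rw [neg_sub, Real.exp_sub, Real.exp_log h0, Real.exp_log hB]
        rw [hr] at hs
        refine ⟨fun x => s • Fin.cons 0 (yS x) + (1 - s) • Fin.cons (t a x) (yB x), fun x =>
          convex_convexHull ℝ _ (hullS x) (htB a x) hs0 (sub_nonneg.2 hs1) (by ring), ?_⟩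
        have holder := sum_mul_exp_le_exp hW hs0 hs1 (hES.trans_eq hp.symm) (hEB.trans_eq hq.symm)
        calc _ ≤ ∑ x, Real.exp ((1 - s) ^ 2 / 4) * (prodWeight w' x * Real.exp
                (s * ((∑ i, yS x i ^ 2) / 4) + (1 - s) * ((∑ i, yB x i ^ 2) / 4))) := by
              refine Finset.sum_le_sum fun x _ => ?_
              rw [mul_left_comm, ← Real.exp_add]
              refine mul_le_mul_of_nonneg_left (Real.exp_le_exp.2 ?_) (hW x)
              beta_reduce
              rw [smul_cons_add_smul_cons]
              simp only [Fin.sum_univ_succ, Fin.cons_zero, Fin.cons_succ, Pi.add_apply,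
                Pi.smul_apply, smul_eq_mul]
              have h₁ : (s * 0 + (1 - s) * t a x) ^ 2 ≤ (1 - s) ^ 2 := by
                rw [mul_zero, zero_add, mul_pow]
                exact mul_le_of_le_one_right (sq_nonneg _) (pow_le_one₀ (ht0 a x) (ht1 a x))
              have h₂ : ∑ i, (s * yS x i + (1 - s) * yB x i) ^ 2 ≤
                  s * (∑ i, yS x i ^ 2) + (1 - s) * ∑ i, yB x i ^ 2 := by
                rw [Finset.mul_sum, Finset.mul_sum, ← Finset.sum_add_distrib]
                refine Finset.sum_le_sum fun i _ => ?_
                nlinarith [mul_nonneg (mul_nonneg hs0 (sub_nonneg.2 hs1))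
                  (sq_nonneg (yS x i - yB x i))]
              linarith
          _ ≤ Real.exp ((1 - s) ^ 2 / 4) *
                Real.exp (s * -Real.log m + (1 - s) * -Real.log b) := by
              rw [← Finset.mul_sum]
              exact mul_le_mul_of_nonneg_left holder (Real.exp_pos _).le
          _ = 1 / b * Real.exp ((1 - s) ^ 2 / 4 + s * (Real.log b - Real.log m)) := by
              rw [← hq, ← Real.exp_add, ← Real.exp_add]
              congr 1
              ring
          _ ≤ _ := mul_le_mul_of_nonneg_left hs (by positivity)
    choose y hy hE using fiber
    refine ⟨fun x => y (x 0) (Fin.tail x), fun x => ?_, ?_⟩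
    · have := hy (x 0) (Fin.tail x)
      rwa [Fin.cons_self_tail] at this
    · rw [sum_fin_succ_pi]
      simp only [Fin.cons_zero, Fin.tail_cons, prodWeight_cons, mul_assoc, ← Finset.mul_sum]
      calc _ ≤ ∑ a, w 0 a * (1 / b * (2 - prodMass w' (S a) / b)) :=
            Finset.sum_le_sum fun a _ => mul_le_mul_of_nonneg_left (hE a) (hw 0 a)
        _ = 2 / b * (∑ a, w 0 a) - (∑ a, w 0 a * prodMass w' (S a)) / b ^ 2 := by
            rw [Finset.mul_sum, Finset.sum_div, ← Finset.sum_sub_distrib]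
            refine Finset.sum_congr rfl fun a _ => ?_
            field_simp
        _ = (2 * b - prodMass w A) / b ^ 2 := by
            rw [hw1, ← hsum]
            field_simp
        _ ≤ _ := by
            rw [div_le_div_iff₀ (by positivity) hA]
            -- With `u = prodMass w A`, this is `u(2b - u) ≤ b²`.
            nlinarith [sq_nonneg (b - prodMass w A)]

/-- Markov's inequality applied to the convex distance. -/
theorem prodMass_mul_prodMass_le (w : Fin n → α → ℝ) (hw : ∀ i a, 0 ≤ w i a)
    (hw1 : ∀ i, ∑ a, w i a = 1) (A B : Finset (Fin n → α)) {r : ℝ}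
    (h : ∀ x ∈ B, ∀ y ∈ convexHull ℝ (diffVec x '' A), r ≤ ∑ i, y i ^ 2) :
    prodMass w A * prodMass w B ≤ Real.exp (-(r / 4)) := by
  obtain hA | hA := (prodMass_nonneg hw A).eq_or_lt
  · rw [← hA, zero_mul]
    exact (Real.exp_pos _).le
  obtain ⟨y, hy, hE⟩ := talagrand_convex_distance w hw hw1 A hA
  have : prodMass w B * Real.exp (r / 4) ≤ 1 / prodMass w A := by
    refine le_trans ?_ hE
    rw [prodMass, Finset.sum_mul]
    refine le_trans (Finset.sum_le_sum fun x hx => ?_)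
      (Finset.sum_le_sum_of_subset_of_nonneg (Finset.subset_univ B) fun x _ _ =>
        mul_nonneg (prodWeight_nonneg hw x) (Real.exp_pos _).le)
    have := h x hx _ (hy x)
    exact mul_le_mul_of_nonneg_left (Real.exp_le_exp.2 (by linarith)) (prodWeight_nonneg hw x)
  rw [le_div_iff₀ hA] at this
  rw [Real.exp_neg, ← one_div, le_div_iff₀ (Real.exp_pos _)]
  linarith

end Talagrand

/-! ### The binomial random graph as a product of independent rows. -/

namespace SimpleGraph

variable {n : ℕ}

/-- The graph whose edges `{i, j}`, `j < i`, are read off from entry `j` of row `i`. -/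
def ofRows (x : Fin n → Fin n → Bool) : SimpleGraph (Fin n) :=
  fromRel fun i j => j < i ∧ x i j = true

lemma ofRows_adj {x : Fin n → Fin n → Bool} {i j : Fin n} :
    (ofRows x).Adj i j ↔ j < i ∧ x i j = true ∨ i < j ∧ x j i = true := by
  rw [ofRows, fromRel_adj, and_iff_right_iff_imp]
  rintro (⟨h, -⟩ | ⟨h, -⟩)
  exacts [h.ne', h.ne]

lemma ofRows_adj_of_lt {x : Fin n → Fin n → Bool} {i j : Fin n} (h : j < i) :
    (ofRows x).Adj i j ↔ x i j = true := by
  simp [ofRows_adj, h, h.not_gt]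

/-- The law of row `i`: independent entries, Bernoulli below the diagonal and `false` elsewhere. -/
noncomputable def rowWeight (p : ℝ) (i : Fin n) (r : Fin n → Bool) : ℝ :=
  ∏ j, if j < i then (if r j then p else 1 - p) else (if r j then 0 else 1)

lemma rowWeight_nonneg {p : ℝ} (h0 : 0 ≤ p) (h1 : p ≤ 1) (i : Fin n) (r : Fin n → Bool) :
    0 ≤ rowWeight p i r := by
  refine Finset.prod_nonneg fun j _ => ?_
  have := sub_nonneg.2 h1
  split_ifs <;> simp [h0, this]

lemma sum_rowWeight (p : ℝ) (i : Fin n) : ∑ r, rowWeight p i r = 1 := by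
  have := Finset.prod_univ_sum (fun _ : Fin n => (Finset.univ : Finset Bool)) fun j b =>
    if j < i then (if b then p else 1 - p) else (if b then 0 else 1)
  rw [Fintype.piFinset_univ] at this
  unfold rowWeight
  rw [← this]
  refine Finset.prod_eq_one fun j _ => ?_
  split_ifs <;> simp

open scoped Classical in
lemma card_adj_lt (G : SimpleGraph (Fin n)) :
    (Finset.univ.filter fun q : Fin n × Fin n => q.2 < q.1 ∧ G.Adj q.1 q.2).card =
      G.edgeSet.ncard := by
  have h : G.edgeSet = (fun q : Fin n × Fin n => s(q.1, q.2)) ''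
      ↑(Finset.univ.filter fun q : Fin n × Fin n => q.2 < q.1 ∧ G.Adj q.1 q.2) := by
    ext e
    induction e with | _ i j
    simp only [mem_edgeSet, Finset.coe_filter, Finset.mem_univ, true_and, Set.mem_image,
      Set.mem_ofPred_eq, Prod.exists]
    constructor
    · intro h
      obtain hlt | hlt := lt_or_gt_of_ne h.ne
      · exact ⟨j, i, ⟨hlt, h.symm⟩, Sym2.eq_swap⟩
      · exact ⟨i, j, ⟨hlt, h⟩, rfl⟩
    · rintro ⟨a, b, ⟨-, h⟩, e⟩
      rw [← mem_edgeSet] at h ⊢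
      rwa [← e]
  rw [h, Set.InjOn.ncard_image, Set.ncard_coe_finset]
  rintro ⟨a, b⟩ hab ⟨c, d⟩ hcd e
  simp only [Finset.coe_filter, Finset.mem_univ, true_and, Set.mem_ofPred_eq] at hab hcd
  obtain ⟨rfl, rfl⟩ | ⟨rfl, rfl⟩ := Sym2.eq_iff.1 e
  · rfl
  · exact absurd hab.1 hcd.1.not_gt

open scoped Classical in
lemma card_not_adj_lt (G : SimpleGraph (Fin n)) :
    (Finset.univ.filter fun q : Fin n × Fin n => q.2 < q.1 ∧ ¬ G.Adj q.1 q.2).card =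
      n.choose 2 - G.edgeSet.ncard := by
  have h := card_adj_lt (⊤ : SimpleGraph (Fin n))
  have e : (⊤ : SimpleGraph (Fin n)).edgeSet.ncard = n.choose 2 := by
    rw [← coe_edgeFinset, Set.ncard_coe_finset, card_edgeFinset_top_eq_card_choose_two,
      Fintype.card_fin]
  rw [← e, ← h, ← card_adj_lt G]
  refine eq_tsub_of_add_eq ?_
  rw [← Finset.card_union_of_disjoint]
  · congr 1
    ext q
    simp only [Finset.mem_union, Finset.mem_filter, Finset.mem_univ, true_and, top_adj,
      ← and_or_left]
    exact ⟨fun h => ⟨h.1, h.1.ne'⟩, fun h => ⟨h.1, (em _).symm⟩⟩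
  · exact Finset.disjoint_filter.2 fun q _ h h' => h.2 h'.2

lemma measurableSingletonClass_simpleGraph {V : Type*} [Countable V] :
    MeasurableSingletonClass (SimpleGraph V) where
  measurableSet_singleton G := by
    have : {G} = edgeSet ⁻¹' {G.edgeSet} := by
      ext
      simp
    rw [this]
    exact measurable_edgeSet (measurableSet_singleton _)

-- Rows also carry entries on and above the diagonal, so many arrays encode `G`; only `xG`, with all
-- of these `false`, can have nonzero weight.
open scoped Classical in
lemma sum_prodWeight_ofRows_eq (p : unitInterval) (G : SimpleGraph (Fin n)) :
    ∑ x with ofRows x = G, prodWeight (rowWeight (n := n) p) x =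
      (binomialRandom (Fin n) p).real {G} := by
  let xG : Fin n → Fin n → Bool := fun i j => decide (j < i ∧ G.Adj i j)
  have hxG : ofRows xG = G := by
    ext i j
    simp only [ofRows_adj, xG, decide_eq_true_eq]
    constructor
    · rintro (⟨-, -, h⟩ | ⟨-, -, h⟩)
      exacts [h, h.symm]
    · intro h
      obtain hlt | hlt := lt_or_gt_of_ne h.ne
      · exact .inr ⟨hlt, hlt, h.symm⟩
      · exact .inl ⟨hlt, hlt, h⟩
  rw [Finset.sum_eq_single xG]
  · have h₁ : prodWeight (rowWeight (n := n) p) xG = ∏ q : Fin n × Fin n,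
        (if q.2 < q.1 ∧ G.Adj q.1 q.2 then (p : ℝ) else 1) *
          (if q.2 < q.1 ∧ ¬ G.Adj q.1 q.2 then 1 - (p : ℝ) else 1) := by
      rw [prodWeight, Fintype.prod_prod_type]
      refine Finset.prod_congr rfl fun i _ => Finset.prod_congr rfl fun j _ => ?_
      by_cases h : j < i <;> by_cases h' : G.Adj i j <;> simp [xG, h, h']
    rw [h₁, Finset.prod_mul_distrib, ← Finset.prod_filter, ← Finset.prod_filter,
      Finset.prod_const, Finset.prod_const, card_adj_lt, card_not_adj_lt, measureReal_def,
      binomialRandom_singleton]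
    simp
  · intro x hx hne
    obtain ⟨i, j, hij⟩ : ∃ i j, x i j ≠ xG i j := by
      by_contra! h
      exact hne (funext fun i => funext fun j => h i j)
    refine Finset.prod_eq_zero (Finset.mem_univ i) (Finset.prod_eq_zero (Finset.mem_univ j) ?_)
    have hlt : ¬ j < i := fun hlt => hij <| by
      rw [Bool.eq_iff_iff, ← ofRows_adj_of_lt hlt, ← ofRows_adj_of_lt hlt, hxG,
        (Finset.mem_filter.1 hx).2]
    simp [xG, hlt] at hij
    simp [hlt, hij]
  · simp [hxG]

open scoped Classical in
lemma prodMass_ofRows_mem (p : unitInterval) (S : Set (SimpleGraph (Fin n))) :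
    prodMass (rowWeight (n := n) p) (Finset.univ.filter fun x => ofRows x ∈ S) =
      (binomialRandom (Fin n) p).real S := by
  have := measurableSingletonClass_simpleGraph (V := Fin n)
  have h := sum_measureReal_singleton (μ := binomialRandom (Fin n) p) S.toFinset
  rw [Set.coe_toFinset] at h
  rw [← h, prodMass, ← Finset.sum_fiberwise_of_maps_to (t := S.toFinset) (g := ofRows) (by simp)]
  refine Finset.sum_congr rfl fun G hG => ?_
  rw [← sum_prodWeight_ofRows_eq, Finset.filter_filter]
  refine Finset.sum_congr (Finset.filter_congr fun x _ => ?_) fun _ _ => rfl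
  exact and_iff_right_of_imp fun h => h ▸ Set.mem_toFinset.1 hG

/-! ### Concentration around the median. -/

/-- The events that `coneTheta` is at most `a` and that it is at least `b` cannot both be likely. -/
theorem binomialRandom_real_mul_le {Q P : ConvexCone ℝ ℝ} (hQ : (0 : ℝ) ∈ Q) (hP : (0 : ℝ) ∈ P)
    (p : unitInterval) {a b : ℝ} (hab : a ≤ b) (ha : 0 ≤ a) (hb : 0 < b) :
    (binomialRandom (Fin n) p).real {G | coneTheta Q P G ≤ a} *
      (binomialRandom (Fin n) p).real {G | b ≤ coneTheta Q P G} ≤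
        Real.exp (-((b - a) ^ 2 / b / 4)) := by
  classical
  rw [← prodMass_ofRows_mem, ← prodMass_ofRows_mem]
  refine prodMass_mul_prodMass_le _ (rowWeight_nonneg p.2.1 p.2.2) (sum_rowWeight _) _ _
    fun x hx y hy => ?_
  simp only [Finset.mem_filter, Finset.mem_univ, true_and, Set.mem_ofPred_eq] at hx
  -- Adjacency of `i` and `j` is stored in the row of the larger one, so vertices with unchanged
  -- rows keep their mutual adjacencies.
  have h := sq_coneTheta_sub_le (G := ofRows x) hQ hP (a := a) (D := diffVec x '' _) (by
    rintro _ ⟨z, hz, rfl⟩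
    refine ⟨fun i => by unfold diffVec; split_ifs <;> simp, ofRows z, by simpa using hz,
      fun i j hi hj => ?_⟩
    have hi : z i = x i := by simpa [diffVec] using hi
    have hj : z j = x j := by simpa [diffVec] using hj
    rw [ofRows_adj, ofRows_adj, hi, hj]) hy (hab.trans hx)
  generalize coneTheta Q P (ofRows x) = T at h hx
  have hT : 0 < T := hb.trans_le hx
  rw [← div_le_iff₀ hT] at h
  refine le_trans ?_ h
  rw [div_le_div_iff₀ hb hT]
  -- Monotonicity of `(T - a)²/T` for `T ≥ b ≥ a`: the difference to be signed is `(T - b)(bT -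
  -- a²)`.
  nlinarith [mul_nonneg (sub_nonneg.2 hx) (sub_nonneg.2 (mul_le_mul hab (hab.trans hx) ha hb.le)),
    mul_nonneg (sub_nonneg.2 hx) (sub_nonneg.2 (mul_le_mul hab hab ha hb.le)),
    mul_nonneg (sub_nonneg.2 hx) (mul_nonneg hb.le (sub_nonneg.2 hx)),
    mul_nonneg (sub_nonneg.2 hx) (mul_nonneg hb.le (sub_nonneg.2 hab))]

/-- The argument gives prefactor 2 and denominators `4(m + ξ)` and `4m`, which the stated constants
weaken. -/
theorem coneTheta_tails {Q P : ConvexCone ℝ ℝ} (hQ : (0 : ℝ) ∈ Q) (hP : (0 : ℝ) ∈ P)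
    (p : unitInterval) {m : ℝ} (hm : IsMedian (binomialRandom (Fin n) p) (coneTheta Q P) m)
    {ξ : ℝ} (hξ : 0 < ξ) :
    (binomialRandom (Fin n) p).real {G | m + ξ ≤ coneTheta Q P G} ≤
      30 * Real.exp (-ξ ^ 2 / (5 * m + 10 * ξ)) ∧
    (binomialRandom (Fin n) p).real {G | coneTheta Q P G ≤ m - ξ} ≤
      3 * Real.exp (-ξ ^ 2 / (10 * m)) := by
  have one_le {a : ℝ} (h : 0 < (binomialRandom (Fin n) p).real {G | coneTheta Q P G ≤ a}) :
      1 ≤ a := by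
    obtain ⟨G, hG⟩ : {G : SimpleGraph (Fin n) | coneTheta Q P G ≤ a}.Nonempty := by
      by_contra he
      simp [Set.not_nonempty_iff_eq_empty.1 he] at h
    exact (one_le_coneTheta hQ hP).trans hG
  have hm1 : 1 ≤ m := one_le (by linarith [hm.1])
  constructor
  · have h := binomialRandom_real_mul_le (n := n) hQ hP p (a := m) (b := m + ξ) (by linarith)
      (by linarith) (by linarith)
    have hle : Real.exp (-((m + ξ - m) ^ 2 / (m + ξ) / 4)) ≤
        Real.exp (-ξ ^ 2 / (5 * m + 10 * ξ)) := by
      rw [Real.exp_le_exp, neg_div, neg_le_neg_iff, add_sub_cancel_left, div_div]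
      exact div_le_div_of_nonneg_left (sq_nonneg _) (by linarith) (by linarith)
    have := mul_le_mul_of_nonneg_right hm.1
      (measureReal_nonneg (μ := binomialRandom (Fin n) p) (s := {G | m + ξ ≤ coneTheta Q P G}))
    linarith [Real.exp_pos (-ξ ^ 2 / (5 * m + 10 * ξ))]
  -- If the lower tail has positive probability then `m - ξ ≥ 1`, because the parameter is at least
  -- 1; this supplies `0 ≤ a`.
  · obtain h0 | h0 := (measureReal_nonneg (μ := binomialRandom (Fin n) p)
      (s := {G | coneTheta Q P G ≤ m - ξ})).eq_or_lt
    · rw [← h0]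
      positivity
    have := one_le h0
    have h := binomialRandom_real_mul_le (n := n) hQ hP p (a := m - ξ) (b := m) (by linarith)
      (by linarith) (by linarith)
    have hle : Real.exp (-((m - (m - ξ)) ^ 2 / m / 4)) ≤ Real.exp (-ξ ^ 2 / (10 * m)) := by
      rw [Real.exp_le_exp, neg_div, neg_le_neg_iff, sub_sub_cancel, div_div]
      exact div_le_div_of_nonneg_left (sq_nonneg _) (by linarith) (by linarith)
    have := mul_le_mul_of_nonneg_left hm.2 h0.le
    linarith [Real.exp_pos (-ξ ^ 2 / (10 * m))]

end SimpleGraph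

theorem theorem1 :
    ∃ n₀ : ℕ, ∀ n : ℕ, n₀ ≤ n → ∀ p : unitInterval, 0 < (p : ℝ) → (p : ℝ) ≤ 0.99 →
      ∀ θ ∈ ({SimpleGraph.lovaszTheta, SimpleGraph.thetaHalf, SimpleGraph.thetaTwo} :
          Set (SimpleGraph (Fin n) → ℝ)),
        ∀ m : ℝ, IsMedian (SimpleGraph.binomialRandom (Fin n) p) θ m →
          (∀ ξ : ℝ, max 10 (√m) ≤ ξ →
            (SimpleGraph.binomialRandom (Fin n) p).real {G | m + ξ ≤ θ G} ≤
              30 * Real.exp (-ξ ^ 2 / (5 * m + 10 * ξ))) ∧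
          (∀ ξ : ℝ, 10 < ξ →
            (SimpleGraph.binomialRandom (Fin n) p).real {G | θ G ≤ m - ξ} ≤
              3 * Real.exp (-ξ ^ 2 / (10 * m))) := by
  refine ⟨0, fun n _ p _ _ θ hθ m hm => ?_⟩
  obtain ⟨Q, P, hQ, hP, rfl⟩ : ∃ Q P : ConvexCone ℝ ℝ, (0 : ℝ) ∈ Q ∧ (0 : ℝ) ∈ P ∧
      θ = SimpleGraph.coneTheta Q P := by
    obtain rfl | rfl | rfl := hθ
    · exact ⟨_, _, SimpleGraph.mem_zeroCone.2 rfl, ConvexCone.mem_top,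
        funext SimpleGraph.lovaszTheta_eq_coneTheta⟩
    · exact ⟨_, _, SimpleGraph.mem_nonposCone.2 le_rfl, ConvexCone.mem_top,
        funext SimpleGraph.thetaHalf_eq_coneTheta⟩
    · exact ⟨_, _, SimpleGraph.mem_zeroCone.2 rfl, SimpleGraph.mem_nonnegCone.2 le_rfl,
        funext SimpleGraph.thetaTwo_eq_coneTheta⟩
  exact ⟨fun ξ hξ => (SimpleGraph.coneTheta_tails hQ hP p hm
      (by linarith [le_max_left 10 (√m)])).1,
    fun ξ hξ => (SimpleGraph.coneTheta_tails hQ hP p hm (by linarith)).2⟩
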